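/- All graphs are finite and simple. For graphs $F$ and $H$ let $c(F,H)$ be the number of subgraphs of $H$ isomorphic to $F$. The $F$-process starting with $H$ is the sequence $(H_i)_{i\ge 0}$ of graphs on $V(H)$ with $H_0=H$ and $$E(H_{i+1})=E(H_i)\cup\Big\{f\in \tbinom{V(H)}{2} : c(F,H_i\cup f)>c(F,H_i)\Big\},$$ where $H_i\cup f$ is $H_i$ with the edge $f$ added and $\binom{V(H)}{2}$ is the set of pairs of distinct vertices of $H$. Its running time is $\tau_F(H)=\min\{t\ge 0 : H_t=H_{t+1}\}$, and $M_F(n)$ is the maximum of $\tau_F(H)$ over all graphs $H$ on $n$ vertices. Write $\chi$ for the chromatic number and $F-e$ for $F$ with the edge $e$ removed (and all vertices kept). **Theorem.** For every graph $F$ and every edge $e$ of $F$, $$M_F(n)\le\left(\frac{\chi(F-e)-2}{\chi(F-e)-1}+o(1)\right)\binom n2,$$ where the fraction is read as $0$ if $F-e$ has no edges. That is, for every $\varepsilon>0$ there is an $n_0$ such that for all $n\ge n_0$ we have $M_F(n)\le\left(\frac{\chi(F-e)-2}{\chi(F-e)-1}+\varepsilon\right)\binom n2$. -/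

import Mathlib

namespace GraphBootstrap

/-- One step of the `F`-process on a graph `H`: add every pair `e` of distinct vertices for which
`H ∪ e` contains more copies of `F` (subgraphs isomorphic to `F`) than `H` does. -/
noncomputable def step {W V : Type*} [Fintype V] (F : SimpleGraph W) (H : SimpleGraph V) :
    SimpleGraph V :=
  H ⊔ SimpleGraph.fromEdgeSet
    {e : Sym2 V | ¬ e.IsDiag ∧
      (H ⊔ SimpleGraph.fromEdgeSet {e}).copyCount F > H.copyCount F}

/-- The `F`-process `H₀ = H, H₁, H₂, …` starting with `H`. -/
noncomputable def process {W V : Type*} [Fintype V] (F : SimpleGraph W) (H : SimpleGraph V) :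
    ℕ → SimpleGraph V
  | 0 => H
  | i + 1 => step F (process F H i)

/-- The running time `τ_F(H)`: the least `t` with `H_t = H_{t+1}`. -/
noncomputable def runningTime {W V : Type*} [Fintype V] (F : SimpleGraph W)
    (H : SimpleGraph V) : ℕ :=
  sInf {t : ℕ | process F H t = process F H (t + 1)}

/-- The maximum running time `M_F(n)` over all graphs `H` on `n` vertices. -/
noncomputable def maxRunningTime {W : Type*} (F : SimpleGraph W) (n : ℕ) : ℕ :=
  sSup {t : ℕ | ∃ H : SimpleGraph (Fin n), t = runningTime F H}

/-- The process becomes stationary, so the minimum defining `runningTime` is attained. -/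
theorem runningTime_isLeast {W V : Type*} [Fintype V] (F : SimpleGraph W) (H : SimpleGraph V) :
    IsLeast {t : ℕ | process F H t = process F H (t + 1)} (runningTime F H) := by
  have hmono : Monotone (process F H) := monotone_nat_of_le_succ fun _ => le_sup_left
  have hne : {t : ℕ | process F H t = process F H (t + 1)}.Nonempty := by
    by_contra hempty
    have hstrict : StrictMono (process F H) := strictMono_nat_of_lt_succ fun i =>
      lt_of_le_of_ne (hmono (Nat.le_succ i)) fun h => hempty ⟨i, h⟩
    exact not_injective_infinite_finite _ hstrict.injective
  exact ⟨Nat.sInf_mem hne, fun _ ht => Nat.sInf_le ht⟩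

/-- The maximum defining `maxRunningTime` is attained. -/
theorem maxRunningTime_isGreatest {W : Type*} (F : SimpleGraph W) (n : ℕ) :
    IsGreatest {t : ℕ | ∃ H : SimpleGraph (Fin n), t = runningTime F H}
      (maxRunningTime F n) := by
  have hfin : {t : ℕ | ∃ H : SimpleGraph (Fin n), t = runningTime F H}.Finite := by
    refine (Set.finite_range fun H : SimpleGraph (Fin n) => runningTime F H).subset ?_
    rintro _ ⟨H, rfl⟩
    exact ⟨H, rfl⟩
  exact ⟨Nat.sSup_mem ⟨_, ⊥, rfl⟩ hfin.bddAbove, fun _ ht => le_csSup hfin.bddAbove ht⟩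

/-- The value `(c - 2) / (c - 1)` for `c ≥ 2`, and `0` for `c ≤ 1` (a graph without edges has
chromatic number at most `1`, and Turán density `0`). -/
noncomputable def chromaticDensity (c : ℕ) : ℝ :=
  if 2 ≤ c then ((c : ℝ) - 2) / ((c : ℝ) - 1) else 0

end GraphBootstrap

/-!
Write `k` for the maximum of `2` and the chromatic number of `F` minus the edge `ab`. Choose, for
each step `i` of a process with running time `T`, an edge `e i` that is new in that step. The graph
formed by these `T` edges contains no large complete `k`-partite graph `K`
(`completeEquipartiteGraph_free_of_new_edges`), so `T` is at most an extremal number of `K`, and the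
Erdős–Stone theorem bounds it by `((k - 2) / (k - 1) + o(1)) * n.choose 2`
(`eventually_extremalNumber_completeEquipartiteGraph_le`).

To see that `K` does not occur, consider the moment at which all but three edges of a copy of `K`
are present. Two steps of the process complete the copy (`step_step_adj`): if `F` itself is
`k`-colourable, every missing edge plays the role of `ab` in a copy of `F` and is added at once.
Otherwise all `k`-colourings of `F` minus `ab` give `a` and `b` the same colour, so that the first
step adds all pairs inside the parts, and the second step all missing edges between them. However,
the three missing edges are new in three different steps.
-/

open Finset

namespace SimpleGraph

/-! ### The Erdős–Stone bound on extremal numbers -/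

/-- The edge version of the Erdős–Stone theorem. Deleting a vertex of minimum degree from a graph
without a large complete `(r + 1)`-partite subgraph removes few edges, by the minimum degree
version, and these bounds are summed over `n`. -/
theorem eventually_extremalNumber_completeEquipartiteGraph_le {r : ℕ} (hr : 0 < r) (t : ℕ)
    {ε : ℝ} (hε : 0 < ε) :
    ∃ n₀ : ℕ, ∀ n : ℕ, n₀ ≤ n →
      (extremalNumber n (completeEquipartiteGraph (r + 1) t) : ℝ) ≤
        (1 - 1 / r + ε) * (n.choose 2 : ℝ) := by
  classical
  set K := completeEquipartiteGraph (r + 1) t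
  have hc : (0 : ℝ) ≤ 1 - 1 / r := by
    have : (1 : ℝ) / r ≤ 1 := by
      rw [div_le_one (by positivity)]
      exact_mod_cast hr
    linarith
  set c : ℝ := 1 - 1 / r
  obtain ⟨N, hN⟩ := Filter.eventually_atTop.mp
    (eventually_completeEquipartiteGraph_isContained_of_minDegree (half_pos hε) r t)
  have hstep : ∀ n, N ≤ n + 1 →
      (extremalNumber (n + 1) K : ℝ) ≤ extremalNumber n K + (c + ε / 2) * (n + 1) := by
    intro n hn
    have hnn : (0 : ℝ) ≤ extremalNumber n K + (c + ε / 2) * (n + 1) := by positivity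
    have key := extremalNumber_le_iff_of_nonneg (V := Fin (n + 1)) K hnn
    rw [Fintype.card_fin] at key
    rw [key]
    intro G _ hG
    have hdeg : (G.minDegree : ℝ) < (c + ε / 2) * (n + 1) := by
      by_contra hcon
      refine hG (hN (n + 1) hn ?_)
      push_cast
      exact not_lt.mp hcon
    obtain ⟨v, hv⟩ := G.exists_minimal_degree_vertex
    have h1 := card_edgeFinset_deleteIncidenceSet_le_extremalNumber hG v
    rw [card_edgeFinset_deleteIncidenceSet, Fintype.card_fin, Nat.add_sub_cancel, ← hv] at h1
    have h2 : #G.edgeFinset ≤ extremalNumber n K + G.minDegree := by lia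
    have h3 : (#G.edgeFinset : ℝ) ≤ extremalNumber n K + G.minDegree := by exact_mod_cast h2
    linarith
  have hsum : ∀ n, N ≤ n → (extremalNumber n K : ℝ) ≤
      extremalNumber N K + (c + ε / 2) * (n.choose 2 + n) := by
    intro n hn
    induction n, hn using Nat.le_induction with
    | base => exact le_add_of_nonneg_right (by positivity)
    | succ n hn ih =>
      have h := hstep n (by lia)
      have hch : ((n + 1).choose 2 : ℝ) = n.choose 2 + n := by
        rw [Nat.choose_succ_succ' n 1, Nat.choose_one_right]
        push_cast
        ring
      rw [hch]
      push_cast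
      nlinarith
  -- The remaining terms are linear in `n`, hence at most `(ε / 2) * n.choose 2` for large `n`.
  set A : ℝ := ((extremalNumber N K : ℕ) : ℝ)
  obtain ⟨m, hm⟩ := exists_nat_ge (4 * (A + c + ε / 2) / ε + 1)
  refine ⟨max (max N m) 1, fun n hn => ?_⟩
  have hnN : N ≤ n := by lia
  have hn1 : (1 : ℝ) ≤ n := by exact_mod_cast (by lia : 1 ≤ n)
  have hnm : 4 * (A + c + ε / 2) / ε + 1 ≤ n := hm.trans (by exact_mod_cast (by lia : m ≤ n))
  have hA0 : 0 ≤ A := Nat.cast_nonneg _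
  have hlin : 4 * (A + c + ε / 2) ≤ (n - 1) * ε := by
    rw [← div_le_iff₀ hε]
    linarith
  have hrest : A + (c + ε / 2) * n ≤ ε / 2 * (n.choose 2 : ℝ) := by
    rw [Nat.cast_choose_two]
    nlinarith [mul_le_mul_of_nonneg_right hlin (by positivity : (0 : ℝ) ≤ n),
      mul_nonneg hA0 (by linarith : (0 : ℝ) ≤ n - 1)]
  have := hsum n hnN
  linarith

/-! ### Counting copies -/

/-- A copy of `F` in `G'` using an edge that is missing from `G ≤ G'` makes the number of copies
strictly larger in `G'`. -/
theorem copyCount_lt_copyCount {V W : Type*} [Fintype V] {F : SimpleGraph W}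
    {G G' : SimpleGraph V} (h : G ≤ G') (f : Copy F G') {a b : W} (hab : F.Adj a b)
    (hnot : ¬ G.Adj (f a) (f b)) : G.copyCount F < G'.copyCount F := by
  classical
  have hinj : Function.Injective (Subgraph.map (Hom.ofLE h)) := by
    intro S S' hS
    have hv := congrArg Subgraph.verts hS
    have hadj := congrArg Subgraph.Adj hS
    ext x y
    · simpa using congrArg (x ∈ ·) hv
    · simpa [Relation.Map] using congrFun₂ hadj x y
  unfold copyCount
  rw [← card_image_of_injective _ hinj]
  refine card_lt_card (ssubset_iff_of_subset ?_ |>.mpr ⟨f.toSubgraph, ?_, ?_⟩)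
  · intro S hS
    simp only [mem_image, mem_filter, mem_univ, true_and] at hS ⊢
    obtain ⟨S, ⟨φ⟩, rfl⟩ := hS
    exact ⟨φ.trans ((Copy.ofLE G G' h).isoSubgraphMap S)⟩
  · simpa using ⟨f.isoToSubgraph⟩
  · simp only [mem_image, mem_filter, mem_univ, true_and, not_exists, not_and]
    intro S _ hS
    have hadj : f.toSubgraph.Adj (f a) (f b) := ⟨a, b, hab, rfl, rfl⟩
    rw [← hS] at hadj
    obtain ⟨x, y, hxy, hx, hy⟩ := hadj
    rw [← hx, ← hy] at hnot
    exact hnot hxy.adj_sub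

end SimpleGraph

namespace GraphBootstrap

open SimpleGraph

variable {V W : Type*} [Fintype V]

/-! ### Edges added by a step of the process -/

theorem le_step (F : SimpleGraph W) (H : SimpleGraph V) : H ≤ step F H := le_sup_left

theorem process_mono (F : SimpleGraph W) (H : SimpleGraph V) : Monotone (process F H) :=
  monotone_nat_of_le_succ fun i => le_step F (process F H i)

/-- An injection of `F` into `H` that sends every edge except possibly `ab` to an edge forces the
image of `ab` to be an edge after one step. -/
theorem step_adj_of_injective {F : SimpleGraph W} {H : SimpleGraph V} {f : W → V}
    (hf : Function.Injective f) {a b : W} (hab : F.Adj a b)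
    (hF : ∀ w w', F.Adj w w' → s(w, w') ≠ s(a, b) → H.Adj (f w) (f w')) :
    (step F H).Adj (f a) (f b) := by
  by_cases hH : H.Adj (f a) (f b)
  · exact le_step F H hH
  have hne : f a ≠ f b := hf.ne hab.ne
  refine Or.inr ((fromEdgeSet_adj _).mpr ⟨⟨by simpa using hne, ?_⟩, hne⟩)
  refine copyCount_lt_copyCount le_sup_left ⟨⟨f, fun {w w'} hw => ?_⟩, hf⟩ hab hH
  by_cases he : s(w, w') = s(a, b)
  · refine Or.inr ((fromEdgeSet_adj _).mpr ⟨?_, hf.ne hw.ne⟩)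
    simpa using congrArg (Sym2.map f) he
  · exact Or.inl (hF w w' hw he)

/-! ### Filling a complete multipartite graph with few missing edges -/

variable [Fintype W] {k M : ℕ} {F : SimpleGraph W} {a b : W}

/-- Vertices `φ (i, j)` with `i : Fin k` and `j : Fin M` are given, and `S` is a small set of
indices `j`. If all edges of `F` other than `ab` are mapped to edges whenever their ends are placed
in the parts prescribed by `c`, at most one of them at an index in `S`, then one step joins any
`φ p` and `φ q` in the parts prescribed for `a` and `b`: send `a` to `p`, `b` to `q`, and all other
vertices to indices outside `S`. -/
theorem step_adj_of_parts {H : SimpleGraph V} {φ : Fin k × Fin M → V}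
    (hφ : Function.Injective φ) {S : Finset (Fin M)} (hM : #S + 2 + Fintype.card W ≤ M)
    (hab : F.Adj a b) {p q : Fin k × Fin M} (hpq : p ≠ q)
    (c : W → Fin k) (hca : c a = p.1) (hcb : c b = q.1)
    (hH : ∀ w w', F.Adj w w' → s(w, w') ≠ s(a, b) → ∀ x y : Fin k × Fin M,
      x.1 = c w → y.1 = c w' → x ≠ y → x.2 ∉ S ∨ y.2 ∉ S → H.Adj (φ x) (φ y)) :
    (step F H).Adj (φ p) (φ q) := by
  classical
  set S' : Finset (Fin M) := insert p.2 (insert q.2 S) with hS'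
  have hcard : #S' ≤ #S + 2 := by
    have h1 := card_insert_le p.2 (insert q.2 S)
    have h2 := card_insert_le q.2 S
    lia
  have hle : Fintype.card W ≤ Fintype.card {j // j ∈ S'ᶜ} := by
    rw [Fintype.card_coe, card_compl, Fintype.card_fin]
    lia
  obtain ⟨g⟩ := Function.Embedding.nonempty_of_card_le hle
  have hg : ∀ w, (g w : Fin M) ≠ p.2 ∧ (g w : Fin M) ≠ q.2 ∧ (g w : Fin M) ∉ S := fun w => by
    have := (g w).2
    simpa [hS'] using this
  let f : W → Fin k × Fin M := fun w => if w = a then p else if w = b then q else (c w, g w)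
  have hfa : f a = p := if_pos rfl
  have hfb : f b = q := (if_neg hab.ne').trans (if_pos rfl)
  have hfo : ∀ w, w ≠ a → w ≠ b → f w = (c w, (g w : Fin M)) := fun w h1 h2 =>
    (if_neg h1).trans (if_neg h2)
  have hf1 : ∀ w, (f w).1 = c w := by
    intro w
    by_cases h1 : w = a
    · rw [h1, hfa, hca]
    by_cases h2 : w = b
    · rw [h2, hfb, hcb]
    rw [hfo w h1 h2]
  have hfinj : Function.Injective f := by
    intro w w' h
    by_contra hne
    have hginj : (g w : Fin M) ≠ g w' := fun h => hne (g.injective (Subtype.ext h))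
    have h2 := congrArg Prod.snd h
    have := hg w
    have := hg w'
    grind
  have := step_adj_of_injective (hφ.comp hfinj) hab (H := H) fun w w' hw he => by
    refine hH w w' hw he _ _ (hf1 w) (hf1 w') (hfinj.ne hw.ne) ?_
    have hw' : (w ≠ a ∧ w ≠ b) ∨ (w' ≠ a ∧ w' ≠ b) := by
      have := hw.ne
      grind
    rcases hw' with h | h
    · left
      rw [hfo w h.1 h.2]
      exact (hg w).2.2
    · right
      rw [hfo w' h.1 h.2]
      exact (hg w').2.2
  simpa [hfa, hfb] using this

/-- A complete `k`-partite graph, all of whose missing edges have both ends at indices in a small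
set `S`, is completed within two steps if `F` minus the edge `ab` is `k`-colourable. If the
colouring separates `a` from `b`, one step joins all pairs in different parts. Otherwise the first
step turns the parts into cliques, and the second joins all remaining pairs. -/
theorem step_step_adj {H : SimpleGraph V} {φ : Fin k × Fin M → V}
    (hφ : Function.Injective φ) {S : Finset (Fin M)} (hM : #S + 2 + Fintype.card W ≤ M)
    (hab : F.Adj a b) (C : (F.deleteEdges {s(a, b)}).Coloring (Fin k))
    (hH : ∀ x y : Fin k × Fin M, x.1 ≠ y.1 → x.2 ∉ S ∨ y.2 ∉ S → H.Adj (φ x) (φ y))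
    {p q : Fin k × Fin M} (hpq : p.1 ≠ q.1) :
    (step F (step F H)).Adj (φ p) (φ q) := by
  classical
  have hC : ∀ w w', F.Adj w w' → s(w, w') ≠ s(a, b) → C w ≠ C w' := fun w w' hw he =>
    C.valid (deleteEdges_adj.mpr ⟨hw, he⟩)
  have hpq' : p ≠ q := fun h => hpq (congrArg Prod.fst h)
  by_cases hCab : C a = C b
  · have hpart : ∀ x y : Fin k × Fin M, x.1 = y.1 → x ≠ y → (step F H).Adj (φ x) (φ y) := by
      intro x y hxy hne
      let σ := Equiv.swap (C a) x.1
      refine step_adj_of_parts hφ hM hab hne (fun w => σ (C w)) (Equiv.swap_apply_left _ _)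
        (by rw [← hCab, ← hxy]; exact Equiv.swap_apply_left _ _) fun w w' hw he x y hx hy _ => ?_
      refine hH x y ?_
      rw [hx, hy]
      exact σ.injective.ne (hC w w' hw he)
    refine step_adj_of_parts hφ hM hab hpq' (fun w => if w = a then p.1 else q.1) (if_pos rfl)
      (if_neg hab.ne') fun w w' _ _ x y _ _ hne hS => ?_
    by_cases hxy : x.1 = y.1
    · exact hpart x y hxy hne
    · exact le_step F H (hH x y hxy hS)
  · apply le_step F
    -- a permutation of the colours sending `C a` to the part of `p` and `C b` to that of `q`
    obtain ⟨σ, hσa, hσb⟩ : ∃ σ : Equiv.Perm (Fin k), σ (C a) = p.1 ∧ σ (C b) = q.1 := by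
      refine ⟨(Equiv.swap (C a) p.1).trans
        (Equiv.swap (Equiv.swap (C a) p.1 (C b)) q.1), ?_, ?_⟩
      · have h1 : Equiv.swap (C a) p.1 (C a) = p.1 := Equiv.swap_apply_left _ _
        have h2 : p.1 ≠ Equiv.swap (C a) p.1 (C b) := by
          rw [← h1]
          exact (h1.symm ▸ (Equiv.swap (C a) p.1).injective.ne hCab)
        rw [Equiv.trans_apply, h1, Equiv.swap_apply_of_ne_of_ne h2 hpq]
      · rw [Equiv.trans_apply, Equiv.swap_apply_left]
    refine step_adj_of_parts hφ hM hab hpq' (fun w => σ (C w)) hσa hσb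
      fun w w' hw he x y hx hy _ => hH x y ?_
    rw [hx, hy]
    exact σ.injective.ne (hC w w' hw he)

/-! ### One new edge for each step -/

/-- The three largest elements of a finite set of natural numbers. -/
theorem exists_three_largest {J : Finset ℕ} (hJ : 3 ≤ #J) :
    ∃ j₁ ∈ J, ∃ j₂ ∈ J, ∃ j₃ ∈ J, j₃ < j₂ ∧ j₂ < j₁ ∧
      ∀ j ∈ J, j < j₃ ∨ j = j₁ ∨ j = j₂ ∨ j = j₃ := by
  have h1 : J.Nonempty := card_pos.mp (by lia)
  set j₁ := J.max' h1 with hj₁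
  have m1 : j₁ ∈ J := J.max'_mem h1
  have c1 := card_erase_of_mem m1
  have h2 : (J.erase j₁).Nonempty := card_pos.mp (by lia)
  set j₂ := (J.erase j₁).max' h2 with hj₂
  have m2 : j₂ ∈ J.erase j₁ := max'_mem _ h2
  have c2 := card_erase_of_mem m2
  have h3 : ((J.erase j₁).erase j₂).Nonempty := card_pos.mp (by lia)
  set j₃ := ((J.erase j₁).erase j₂).max' h3 with hj₃
  have m3 : j₃ ∈ (J.erase j₁).erase j₂ := max'_mem _ h3
  have l1 : ∀ j ∈ J, j ≤ j₁ := fun j hj => le_max' _ _ hj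
  have l2 : ∀ j ∈ J.erase j₁, j ≤ j₂ := fun j hj => le_max' _ _ hj
  have l3 : ∀ j ∈ (J.erase j₁).erase j₂, j ≤ j₃ := fun j hj => le_max' _ _ hj
  simp only [mem_erase] at m2 m3 l2 l3
  refine ⟨j₁, m1, j₂, m2.2, j₃, m3.2.2, ?_, ?_, fun j hj => ?_⟩
  · exact lt_of_le_of_ne (l2 _ m3.2) m3.1
  · exact lt_of_le_of_ne (l1 _ m2.2) m2.1
  · have := l3 j
    grind

/-- Edges `e i`, one that is new in step `i` for each `i < T`, do not contain a large complete
`k`-partite graph, since its last three edges would appear within two consecutive steps. -/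
theorem completeEquipartiteGraph_free_of_new_edges (hk : 2 ≤ k) (hab : F.Adj a b)
    (C : (F.deleteEdges {s(a, b)}).Coloring (Fin k)) (hM : 8 + Fintype.card W ≤ M)
    {H : SimpleGraph V} {T : ℕ} {e : ℕ → Sym2 V}
    (he : ∀ i < T, e i ∈ (process F H (i + 1)).edgeSet ∧ e i ∉ (process F H i).edgeSet) :
    (completeEquipartiteGraph k M).Free (fromEdgeSet (e '' Set.Iio T)) := by
  classical
  rintro ⟨φ⟩
  have hφ : Function.Injective φ := φ.injective
  have htime : ∀ x y : Fin k × Fin M, x.1 ≠ y.1 → ∃ i < T, e i = s(φ x, φ y) := by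
    intro x y hxy
    obtain ⟨i, hi, h⟩ := ((fromEdgeSet_adj _).mp (φ.toHom.map_adj
      (completeEquipartiteGraph_adj.mpr hxy))).1
    exact ⟨i, hi, h⟩
  let J : Finset ℕ := {i ∈ range T | ∃ x y : Fin k × Fin M, x.1 ≠ y.1 ∧ e i = s(φ x, φ y)}
  have hJ : ∀ i, i ∈ J ↔ i < T ∧ ∃ x y : Fin k × Fin M, x.1 ≠ y.1 ∧ e i = s(φ x, φ y) :=
    fun i => by simp [J]
  -- the edges between one vertex of the first part and all vertices of the second
  have hJcard : 3 ≤ #J := by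
    let o : Fin k := ⟨0, by lia⟩
    let l : Fin k := ⟨1, by lia⟩
    have hol : o ≠ l := by simp [o, l]
    let z : Fin M := ⟨0, by lia⟩
    choose τ hτT hτ using fun t : Fin M => htime (o, z) (l, t) hol
    have hτinj : Function.Injective τ := by
      intro t t' h
      have h1 : s(φ (o, z), φ (l, t)) = s(φ (o, z), φ (l, t')) := by rw [← hτ, ← hτ, h]
      have h2 := hφ (Sym2.congr_right.mp h1)
      exact congrArg Prod.snd h2
    calc 3 ≤ M := by lia
      _ = #(univ.image τ) := by rw [card_image_of_injective _ hτinj, card_univ, Fintype.card_fin]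
      _ ≤ #J := card_le_card fun i hi => by
        obtain ⟨t, -, rfl⟩ := mem_image.mp hi
        exact (hJ _).mpr ⟨hτT t, _, _, hol, hτ t⟩
  obtain ⟨j₁, h₁, j₂, h₂, j₃, h₃, h32, h21, hlast⟩ := exists_three_largest hJcard
  obtain ⟨hT₁, x₁, y₁, hxy₁, he₁⟩ := (hJ j₁).mp h₁
  obtain ⟨-, x₂, y₂, -, he₂⟩ := (hJ j₂).mp h₂
  obtain ⟨-, x₃, y₃, -, he₃⟩ := (hJ j₃).mp h₃
  let S : Finset (Fin M) := {x₁.2, y₁.2, x₂.2, y₂.2, x₃.2, y₃.2}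
  have hS : #S ≤ 6 := card_le_six
  -- an edge of the copy that is among the last three has both ends at indices in `S`
  have hmem : ∀ {x y x' y' : Fin k × Fin M}, x'.2 ∈ S → y'.2 ∈ S →
      s(φ x, φ y) = s(φ x', φ y') → x.2 ∈ S ∧ y.2 ∈ S := by
    intro x y x' y' hx' hy' h
    rcases Sym2.eq_iff.mp h with ⟨h1, h2⟩ | ⟨h1, h2⟩
    · rw [hφ h1, hφ h2]
      exact ⟨hx', hy'⟩
    · rw [hφ h1, hφ h2]
      exact ⟨hy', hx'⟩
  have hfill := step_step_adj (H := process F H j₃) hφ (S := S) (by lia) hab C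
    (fun x y hxy hout => by
      obtain ⟨i, hi, hie⟩ := htime x y hxy
      have hlt : i < j₃ := by
        rcases hlast i ((hJ i).mpr ⟨hi, x, y, hxy, hie⟩) with h | rfl | rfl | rfl
        · exact h
        · have := hmem (by simp [S]) (by simp [S]) (hie.symm.trans he₁)
          tauto
        · have := hmem (by simp [S]) (by simp [S]) (hie.symm.trans he₂)
          tauto
        · have := hmem (by simp [S]) (by simp [S]) (hie.symm.trans he₃)
          tauto
      have hedge := (he i hi).1
      rw [hie, mem_edgeSet] at hedge
      exact process_mono F H hlt hedge) hxy₁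
  refine (he j₁ hT₁).2 ?_
  rw [he₁, mem_edgeSet]
  exact process_mono F H (show j₃ + 2 ≤ j₁ by lia) hfill

theorem runningTime_le_extremalNumber (hk : 2 ≤ k) (hab : F.Adj a b)
    (C : (F.deleteEdges {s(a, b)}).Coloring (Fin k)) (H : SimpleGraph V) :
    runningTime F H ≤ extremalNumber (Fintype.card V)
      (completeEquipartiteGraph k (8 + Fintype.card W)) := by
  classical
  have hnew : ∀ i < runningTime F H, ∃ f : Sym2 V,
      f ∈ (process F H (i + 1)).edgeSet ∧ f ∉ (process F H i).edgeSet := by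
    intro i hi
    have hne : ¬ process F H (i + 1) ≤ process F H i := fun h =>
      hi.not_ge ((runningTime_isLeast F H).2 ((process_mono F H i.le_succ).antisymm h))
    rwa [← edgeSet_subset_edgeSet, Set.not_subset] at hne
  rcases Nat.eq_zero_or_pos (runningTime F H) with h0 | hpos
  · exact h0 ▸ Nat.zero_le _
  have : Nonempty (Sym2 V) := ⟨(hnew 0 hpos).choose⟩
  choose! e he using hnew
  have hinj : Set.InjOn e (Set.Iio (runningTime F H)) := by
    have hlt : ∀ i j, i < j → j < runningTime F H → e i ≠ e j := fun i j hij hj h =>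
      (he j hj).2 (h ▸ edgeSet_mono (process_mono F H hij) (he i (hij.trans hj)).1)
    intro i hi j hj h
    by_contra hne
    rcases lt_or_gt_of_ne hne with hij | hij
    · exact hlt i j hij hj h
    · exact hlt j i hij hi h.symm
  have hfree := completeEquipartiteGraph_free_of_new_edges hk hab C le_rfl he
  refine le_trans (le_of_eq ?_) (card_edgeFinset_le_extremalNumber hfree)
  have hedge : (fromEdgeSet (e '' Set.Iio (runningTime F H))).edgeFinset =
      (range (runningTime F H)).image e := by
    ext f
    simp only [mem_edgeFinset, edgeSet_fromEdgeSet, Set.mem_sdiff, Set.mem_image, Set.mem_Iio,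
      mem_image, mem_range]
    refine ⟨And.left, fun h => ⟨h, ?_⟩⟩
    obtain ⟨i, hi, rfl⟩ := h
    exact not_isDiag_of_mem_edgeSet _ (he i hi).1
  have hcard : #((range (runningTime F H)).image e) = runningTime F H := by
    rw [card_image_of_injOn (by simpa using hinj), card_range]
  rw [← hedge] at hcard
  convert hcard.symm

/-- The density `chromaticDensity c` is that of the Turán graph with `max c 2 - 1` parts. -/
theorem chromaticDensity_eq (c : ℕ) :
    chromaticDensity c = 1 - 1 / ((max c 2 - 1 : ℕ) : ℝ) := by
  unfold chromaticDensity
  split_ifs with h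
  · have h1 : ((c : ℝ) - 1) ≠ 0 := by
      have : (2 : ℝ) ≤ c := by exact_mod_cast h
      linarith
    rw [max_eq_left h, Nat.cast_sub (by lia), Nat.cast_one]
    field_simp
    ring
  · rw [max_eq_right (by lia)]
    norm_num

end GraphBootstrap

theorem theorem1p2 {W : Type*} [Fintype W] (F : SimpleGraph W) (e : Sym2 W)
    (he : e ∈ F.edgeSet) :
    ∀ ε : ℝ, 0 < ε → ∃ n₀ : ℕ, ∀ n : ℕ, n₀ ≤ n →
      (GraphBootstrap.maxRunningTime F n : ℝ) ≤
        (GraphBootstrap.chromaticDensity (F.deleteEdges {e}).chromaticNumber.toNat + ε) *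
          (n.choose 2 : ℝ) := by
  intro ε hε
  induction e with | _ a b
  set k := max (F.deleteEdges {s(a, b)}).chromaticNumber.toNat 2 with hk
  have hk2 : 2 ≤ k := le_max_right _ _
  obtain ⟨C⟩ : (F.deleteEdges {s(a, b)}).Colorable k :=
    (SimpleGraph.colorable_chromaticNumber_of_fintype _).mono (le_max_left _ _)
  obtain ⟨n₀, hn₀⟩ := SimpleGraph.eventually_extremalNumber_completeEquipartiteGraph_le
    (r := k - 1) (by lia) (8 + Fintype.card W) hε
  refine ⟨n₀, fun n hn => ?_⟩
  rw [GraphBootstrap.chromaticDensity_eq, ← hk]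
  refine le_trans ?_ (hn₀ n hn)
  rw [Nat.sub_add_cancel (by lia : 1 ≤ k)]
  obtain ⟨H, hH⟩ := (GraphBootstrap.maxRunningTime_isGreatest F n).1
  have h := GraphBootstrap.runningTime_le_extremalNumber hk2 he C H
  rw [Fintype.card_fin] at h
  rw [hH]
  exact_mod_cast h
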